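/- Let $\mathcal L_{PA}$ be the first-order language with equality of Peano arithmetic, with a function symbol for every (code of a) primitive recursive function, among them $0$ and $S$, and a predicate symbol $R_f$ for every such code $f$. In the standard model $\mathbb N$ the function symbols have their usual meaning and $R_f(\vec x)$ means $f(\vec x)=0$. Let $\mathcal L$ be $\mathcal L_{PA}$ together with one new unary predicate symbol $I$; we write $t\in I$ for $It$. Let $A(x,X)$ be a formula of $\mathcal L_{PA}$ extended by a unary second-order variable $X$, with no free first-order variable other than $x$ and no second-order quantifiers, in which $X$ occurs only positively. The theory $ID_1$ (for $A$) is the theory in classical first-order logic with equality, in the language $\mathcal L$, whose axioms are the universal closures of the following formulas: - $\neg\, Sx=0$ and $Sx=Sy\rightarrow x=y$; - the defining equations of all the primitive recursive function symbols, and $R_f(\vec x)\leftrightarrow f(\vec x)=0$ for the predicate symbols; - induction: $\psi(0)\wedge\forall x(\psi(x)\rightarrow\psi(Sx))\rightarrow\forall x\,\psi(x)$, for every formula $\psi$ of $\mathcal L$ (parameters allowed); - inductive definition: $\forall x(x\in I\leftrightarrow A(x,I))$; - inductive closure: $\forall x(A(x,\psi)\rightarrow\psi(x))\rightarrow\forall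 x(x\in I\rightarrow\psi(x))$, for every formula $\psi$ of $\mathcal L$ (parameters allowed), where $A(x,\psi)$ arises from $A(x,X)$ by replacing each atom $t\in X$ by $\psi(t)$. **Theorem ($1$-consistency of $ID_1$).** Let $\phi(x)$ be a quantifier-free formula with no free variable other than $x$ that does not contain the symbol $I$. If $ID_1\vdash\exists x\,\phi(x)$, then there is a natural number $n$ such that $\phi(n)$ holds, i.e. is true in the standard model $\mathbb N$. -/

import Mathlib

/-! ### First-order logic: substitution and derivability

Formulas with `n` free variables are `L.BoundedFormula Empty n`; the variable bound by the quantifier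
of `φ.all`, with `φ : L.BoundedFormula Empty (n + 1)`, is the last one, `Fin.last n`. -/

namespace FOL

open FirstOrder FirstOrder.Language

variable {L : FirstOrder.Language.{0, 0}}

/-- Terms with `n` variables. -/
abbrev Tm (L : FirstOrder.Language.{0, 0}) (n : ℕ) : Type := L.Term (Empty ⊕ Fin n)

/-- Formulas with `n` free variables. -/
abbrev Fm (L : FirstOrder.Language.{0, 0}) (n : ℕ) : Type := L.BoundedFormula Empty n

/-- The `i`-th variable. -/
def v {n : ℕ} (i : Fin n) : Tm L n := Term.var (Sum.inr i)

/-- A term with `n` variables, seen as a term with one more variable. -/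
def wkTm {n : ℕ} (t : Tm L n) : Tm L (n + 1) := t.relabel (Sum.map id Fin.castSucc)

/-- Simultaneous substitution of terms for the variables of a term. -/
def substTm {n m : ℕ} (t : Tm L n) (σ : Fin n → Tm L m) : Tm L m :=
  Term.subst t (Sum.elim (fun e => e.elim) σ)

/-- A substitution, extended by the identity on one new (last) variable. -/
def up {n m : ℕ} (σ : Fin n → Tm L m) : Fin (n + 1) → Tm L (m + 1) :=
  Fin.snoc (α := fun _ => Tm L (m + 1)) (fun i => wkTm (σ i)) (v (Fin.last m))

/-- Simultaneous capture-avoiding substitution of terms for the free variables of a formula. -/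
def subst : {n : ℕ} → Fm L n → {m : ℕ} → (Fin n → Tm L m) → Fm L m
  | _, .falsum, _, _ => .falsum
  | _, .equal s t, _, σ => .equal (substTm s σ) (substTm t σ)
  | _, .rel R ts, _, σ => .rel R (fun i => substTm (ts i) σ)
  | _, .imp φ ψ, _, σ => .imp (subst φ σ) (subst ψ σ)
  | _, .all φ, _, σ => .all (subst φ (up σ))

/-- A formula with `n` free variables, seen as a formula with one more free variable. -/
def wk {n : ℕ} (φ : Fm L n) : Fm L (n + 1) := subst φ (fun i => v i.castSucc)

/-- `φ(t)`: substitution of the term `t` for the last free variable of `φ`. -/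
def inst {n : ℕ} (φ : Fm L (n + 1)) (t : Tm L n) : Fm L n :=
  subst φ (Fin.snoc (α := fun _ => Tm L n) v t)

/-- Natural deduction for classical first-order logic with equality; `Derives Γ φ` says that `φ`
has a derivation from the formulas in `Γ`, all with free variables among the first `n`. The
primitive connectives are `⊥`, `→`, `∀`; the others are Mathlib's abbreviations. -/
inductive Derives : {n : ℕ} → Set (Fm L n) → Fm L n → Prop
  | assumption {n : ℕ} {Γ : Set (Fm L n)} {φ : Fm L n} : φ ∈ Γ → Derives Γ φ
  | impI {n : ℕ} {Γ : Set (Fm L n)} {φ ψ : Fm L n} :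
      Derives (insert φ Γ) ψ → Derives Γ (φ.imp ψ)
  | impE {n : ℕ} {Γ : Set (Fm L n)} {φ ψ : Fm L n} :
      Derives Γ (φ.imp ψ) → Derives Γ φ → Derives Γ ψ
  | raa {n : ℕ} {Γ : Set (Fm L n)} {φ : Fm L n} :
      Derives (insert φ.not Γ) .falsum → Derives Γ φ
  | allI {n : ℕ} {Γ : Set (Fm L n)} {φ : Fm L (n + 1)} :
      Derives (wk '' Γ) φ → Derives Γ φ.all
  | allE {n : ℕ} {Γ : Set (Fm L n)} {φ : Fm L (n + 1)} (t : Tm L n) :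
      Derives Γ φ.all → Derives Γ (inst φ t)
  | eqRefl {n : ℕ} {Γ : Set (Fm L n)} (t : Tm L n) : Derives Γ (.equal t t)
  | eqSubst {n : ℕ} {Γ : Set (Fm L n)} {s t : Tm L n} (φ : Fm L (n + 1)) :
      Derives Γ (.equal s t) → Derives Γ (inst φ s) → Derives Γ (inst φ t)

/-- `T ⊢ σ` for a theory `T` and a sentence `σ`. -/
def Provable (T : L.Theory) (σ : L.Sentence) : Prop := Derives (n := 0) T σ

end FOL

/-! ### The languages of arithmetic and of `ID₁` -/

namespace ID1

open FirstOrder FirstOrder.Language FOL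

/-- Codes for the primitive recursive functions of each arity. -/
inductive PR : ℕ → Type
  | zero : PR 0
  | succ : PR 1
  | proj {n : ℕ} (i : Fin n) : PR n
  | comp {n m : ℕ} (f : PR m) (g : Fin m → PR n) : PR n
  | prec {n : ℕ} (f : PR n) (g : PR (n + 2)) : PR (n + 1)

/-- The primitive recursive function with a given code. -/
def PR.eval : {n : ℕ} → PR n → (Fin n → ℕ) → ℕ
  | _, .zero, _ => 0
  | _, .succ, x => x 0 + 1
  | _, .proj i, x => x i
  | _, .comp f g, x => f.eval (fun i => (g i).eval x)
  | _, .prec f g, x =>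
      Nat.rec (f.eval (Fin.tail x))
        (fun y z => g.eval (Fin.cons y (Fin.cons z (Fin.tail x) : Fin _ → ℕ))) (x 0)

/-- The language of Peano arithmetic: a function symbol for every primitive recursive function
and a predicate symbol `R_f` for (the zero set of) every primitive recursive function `f`. -/
def arith : FirstOrder.Language.{0, 0} where
  Functions := PR
  Relations := PR

/-- The standard model. -/
instance : arith.Structure ℕ where
  funMap := fun (f : PR _) x => f.eval x
  RelMap := fun (f : PR _) x => f.eval x = 0

/-- Predicate symbols of `ID₁`: those of arithmetic and the unary `I`. -/
inductive Rel : ℕ → Type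
  | arith {n : ℕ} (f : PR n) : Rel n
  | I : Rel 1

/-- The language of `ID₁`. -/
def lang : FirstOrder.Language.{0, 0} where
  Functions := PR
  Relations := Rel

/-- The inclusion of the language of arithmetic into the language of `ID₁`. -/
def incl : arith →ᴸ lang where
  onFunction := fun _ f => f
  onRelation := fun _ f => Rel.arith f

/-- The term `f(ts)`. -/
def app {n k : ℕ} (f : PR k) (ts : Fin k → Tm lang n) : Tm lang n :=
  Term.func (L := lang) f ts

/-- The term `0`. -/
def zeroT {n : ℕ} : Tm lang n := app PR.zero ![]

/-- The term `S t`. -/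
def succT {n : ℕ} (t : Tm lang n) : Tm lang n := app PR.succ ![t]

/-- The formula `t ∈ I`. -/
def mem {n : ℕ} (t : Tm lang n) : Fm lang n := .rel (L := lang) Rel.I ![t]

/-- The formula `R_f(ts)`. -/
def relF {n k : ℕ} (f : PR k) (ts : Fin k → Tm lang n) : Fm lang n :=
  .rel (L := lang) (Rel.arith f) ts

/-- `Occurs true φ`: the predicate `I` occurs only positively in `φ`;
`Occurs false φ`: it occurs only negatively. -/
def Occurs : {n : ℕ} → Bool → Fm lang n → Prop
  | _, _, .falsum => True
  | _, _, .equal _ _ => True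
  | _, _, .rel (Rel.arith _) _ => True
  | _, b, .rel Rel.I _ => b = true
  | _, b, .imp φ ψ => Occurs (!b) φ ∧ Occurs b ψ
  | _, b, .all φ => Occurs b φ

/-- Replacement of each atom `t ∈ I` in a formula with `k` free variables by `φ(t)`. The last
variable of `φ` is the one for which `t` is substituted, the `n` others are parameters, and `ρ`
says which variables they are in the result. -/
def replaceI {n : ℕ} (φ : Fm lang (n + 1)) :
    {k : ℕ} → (Fin n → Fin k) → Fm lang k → Fm lang k
  | _, _, .falsum => .falsum
  | _, _, .equal s t => .equal s t
  | _, _, .rel (Rel.arith f) ts => relF f ts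
  | k, ρ, .rel Rel.I ts =>
      subst φ (Fin.snoc (α := fun _ => Tm lang k) (fun i => v (ρ i)) (ts 0))
  | _, ρ, .imp χ ψ => .imp (replaceI φ ρ χ) (replaceI φ ρ ψ)
  | _, ρ, .all χ => .all (replaceI φ (fun i => (ρ i).castSucc) χ)

/-- `A(x, φ)` for `A` with the one free variable `x`, in which the second order variable `X` is
written as `I`, and for `φ` with `n` parameters; the free variables of the result are the
parameters and, as the last one, `x`. -/
def plug {n : ℕ} (A : Fm lang 1) (φ : Fm lang (n + 1)) : Fm lang (n + 1) :=
  replaceI φ Fin.castSucc (subst A (fun _ => v (Fin.last n)))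

/-- The axioms of `ID₁` for the operator form `A(x, X)`, whose second order variable `X` is
written as `I`, so that `A(x, I)` is `A` itself. Open axioms and schemes with parameters are
universally closed by `alls`. -/
inductive IsAxiom (A : Fm lang 1) : lang.Sentence → Prop
  | succ_ne_zero : IsAxiom A
      (BoundedFormula.equal (succT (v (0 : Fin 1))) zeroT).not.alls
  | succ_inj : IsAxiom A
      ((BoundedFormula.equal (succT (v (0 : Fin 2))) (succT (v 1))).imp
        (.equal (v 0) (v 1))).alls
  | proj {n : ℕ} (i : Fin n) : IsAxiom A
      (BoundedFormula.equal (app (PR.proj i) v) (v i)).alls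
  | comp {n m : ℕ} (f : PR m) (g : Fin m → PR n) : IsAxiom A
      (BoundedFormula.equal (app (PR.comp f g) v) (app f (fun i => app (g i) v))).alls
  | prec_zero {n : ℕ} (f : PR n) (g : PR (n + 2)) : IsAxiom A
      (BoundedFormula.equal
        (app (PR.prec f g) (Fin.cons (α := fun _ => Tm lang n) zeroT v)) (app f v)).alls
  | prec_succ {n : ℕ} (f : PR n) (g : PR (n + 2)) : IsAxiom A
      (BoundedFormula.equal
        (app (PR.prec f g) (Fin.cons (α := fun _ => Tm lang (n + 1)) (succT (v 0))
          (fun i => v i.succ)))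
        (app g (Fin.cons (α := fun _ => Tm lang (n + 1)) (v 0)
          (Fin.cons (α := fun _ => Tm lang (n + 1)) (app (PR.prec f g) v)
            (fun i => v i.succ))))).alls
  | pred {n : ℕ} (f : PR n) : IsAxiom A
      ((relF f v).iff (.equal (app f v) zeroT)).alls
  /-- Induction: `φ(0) ∧ ∀x (φ(x) → φ(Sx)) → ∀x φ(x)`. -/
  | induction {n : ℕ} (φ : Fm lang (n + 1)) : IsAxiom A
      ((inst φ zeroT ⊓
        (φ.imp (subst φ (Fin.snoc (α := fun _ => Tm lang (n + 1)) (fun i => v i.castSucc)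
          (succT (v (Fin.last n)))))).all).imp φ.all).alls
  /-- Inductive definition: `∀x (x ∈ I ↔ A(x, I))`. -/
  | inductiveDefinition : IsAxiom A ((mem (v 0)).iff A).all
  /-- Inductive closure: `∀x (A(x, φ) → φ(x)) → ∀x (x ∈ I → φ(x))`. -/
  | inductiveClosure {n : ℕ} (φ : Fm lang (n + 1)) : IsAxiom A
      (((plug A φ).imp φ).all.imp ((mem (v (Fin.last n))).imp φ).all).alls

/-- The theory `ID₁` for the operator form `A`. -/
def theory (A : Fm lang 1) : lang.Theory := {σ | IsAxiom A σ}

end ID1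

/-! ### Soundness of natural deduction -/

namespace FOL

open FirstOrder FirstOrder.Language

variable {L : FirstOrder.Language.{0, 0}} {M : Type} [L.Structure M]

/-! The proof is semantic. Since `X` occurs only positively in `A`, the operator taking `S` to the
set of all `a` with `A(a, S)` is monotone (`Occurs.holds_mono`), so by Knaster–Tarski it has a least
fixed point. Interpreting `I` by that set turns `ℕ` into a model of `ID₁` (`IsAxiom.holds`): the
fixed point equation gives inductive definition, and leastness, applied to the set defined by a
formula via `holds_plug`, gives inductive closure. By `Derives.sound` the provable existential
sentence is true there, and its witness works in `ℕ` because the matrix does not mention `I`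
(`holds_incl`). -/

/-- The value of a term under an assignment of its variables. -/
def val {n : ℕ} (t : Tm L n) (x : Fin n → M) : M := t.realize (Sum.elim Empty.elim x)

/-- Truth of a formula under an assignment of its free variables. -/
def Sat {n : ℕ} (φ : Fm L n) (x : Fin n → M) : Prop := φ.Realize Empty.elim x

@[simp] theorem val_v {n : ℕ} (i : Fin n) (x : Fin n → M) : val (v i : Tm L n) x = x i := rfl

theorem val_wkTm {n : ℕ} (t : Tm L n) (x : Fin (n + 1) → M) :
    val (wkTm t) x = val t (fun i => x i.castSucc) := by
  unfold val wkTm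
  rw [Term.realize_relabel]
  congr 1
  funext i
  rcases i with e | i
  · exact e.elim
  · rfl

theorem val_substTm {n m : ℕ} (t : Tm L n) (σ : Fin n → Tm L m) (x : Fin m → M) :
    val (substTm t σ) x = val t (fun i => val (σ i) x) := by
  unfold val substTm
  rw [Term.realize_subst]
  congr 1
  funext i
  rcases i with e | i
  · exact e.elim
  · rfl

@[simp] theorem sat_falsum {n : ℕ} (x : Fin n → M) :
    Sat (BoundedFormula.falsum : Fm L n) x ↔ False := Iff.rfl

@[simp] theorem sat_equal {n : ℕ} (s t : Tm L n) (x : Fin n → M) :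
    Sat (BoundedFormula.equal s t : Fm L n) x ↔ val s x = val t x := Iff.rfl

@[simp] theorem sat_rel {n k : ℕ} (R : L.Relations k) (ts : Fin k → Tm L n) (x : Fin n → M) :
    Sat (BoundedFormula.rel R ts : Fm L n) x ↔ Structure.RelMap R (fun i => val (ts i) x) :=
  Iff.rfl

@[simp] theorem sat_imp {n : ℕ} (φ ψ : Fm L n) (x : Fin n → M) :
    Sat (φ.imp ψ) x ↔ (Sat φ x → Sat ψ x) := Iff.rfl

@[simp] theorem sat_all {n : ℕ} (φ : Fm L (n + 1)) (x : Fin n → M) :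
    Sat φ.all x ↔ ∀ a : M, Sat φ (Fin.snoc (α := fun _ => M) x a) := Iff.rfl

@[simp] theorem sat_not {n : ℕ} (φ : Fm L n) (x : Fin n → M) :
    Sat φ.not x ↔ ¬ Sat φ x := Iff.rfl

@[simp] theorem sat_inf {n : ℕ} (φ ψ : Fm L n) (x : Fin n → M) :
    Sat (φ ⊓ ψ) x ↔ Sat φ x ∧ Sat ψ x := BoundedFormula.realize_inf

@[simp] theorem sat_iff {n : ℕ} (φ ψ : Fm L n) (x : Fin n → M) :
    Sat (φ.iff ψ) x ↔ (Sat φ x ↔ Sat ψ x) := BoundedFormula.realize_iff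

theorem sat_ex {n : ℕ} (φ : Fm L (n + 1)) (x : Fin n → M) :
    Sat φ.ex x ↔ ∃ a : M, Sat φ (Fin.snoc (α := fun _ => M) x a) := BoundedFormula.realize_ex

theorem sat_alls {n : ℕ} (φ : Fm L n) (x : Fin 0 → M) :
    Sat φ.alls x ↔ ∀ y : Fin n → M, Sat φ y := by
  induction n with
  | zero => exact ⟨fun h y => Subsingleton.elim x y ▸ h, fun h => h x⟩
  | succ n ih =>
    refine (ih φ.all).trans ⟨fun h y => ?_, fun h y a => h _⟩
    have := h (Fin.init y) (y (Fin.last n))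
    rwa [Fin.snoc_init_self] at this

/-- The quantifier case of `sat_subst`; an equation of whole assignments, so that it can rewrite
under `Sat`. -/
theorem val_up {n m : ℕ} (σ : Fin n → Tm L m) (x : Fin m → M) (a : M) :
    (fun i => val (up σ i) (Fin.snoc (α := fun _ => M) x a)) =
      Fin.snoc (α := fun _ => M) (fun i => val (σ i) x) a := by
  funext i
  refine Fin.lastCases ?_ (fun i => ?_) i
  · simp [up]
  · simp [up, val_wkTm]

theorem sat_subst {n : ℕ} (φ : Fm L n) {m : ℕ} (σ : Fin n → Tm L m) (x : Fin m → M) :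
    Sat (subst φ σ) x ↔ Sat φ (fun i => val (σ i) x) := by
  induction φ generalizing m with
  | falsum => simp [subst]
  | equal s t => simp [subst, val_substTm]
  | rel R ts => simp [subst, val_substTm]
  | imp φ ψ ihφ ihψ => simp [subst, ihφ, ihψ]
  | all φ ih => simp [subst, ih, val_up]

theorem sat_wk {n : ℕ} (φ : Fm L n) (x : Fin n → M) (a : M) :
    Sat (wk φ) (Fin.snoc (α := fun _ => M) x a) ↔ Sat φ x := by
  simp [wk, sat_subst]

theorem val_snoc {n m : ℕ} (σ : Fin n → Tm L m) (t : Tm L m) (x : Fin m → M) :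
    (fun i => val (Fin.snoc (α := fun _ => Tm L m) σ t i) x) =
      Fin.snoc (α := fun _ => M) (fun i => val (σ i) x) (val t x) := by
  funext i
  refine Fin.lastCases ?_ (fun i => ?_) i <;> simp

theorem sat_inst {n : ℕ} (φ : Fm L (n + 1)) (t : Tm L n) (x : Fin n → M) :
    Sat (inst φ t) x ↔ Sat φ (Fin.snoc (α := fun _ => M) x (val t x)) := by
  simp [inst, sat_subst, val_snoc]

/-- Derivable formulas are true wherever the assumptions are. -/
theorem Derives.sound {n : ℕ} {Γ : Set (Fm L n)} {φ : Fm L n} (h : Derives Γ φ)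
    (x : Fin n → M) (hx : ∀ ψ ∈ Γ, Sat ψ x) : Sat φ x := by
  induction h with
  | assumption hφ => exact hx _ hφ
  | impI _ ih => exact fun hφ => ih x (Set.forall_mem_insert.2 ⟨hφ, hx⟩)
  | impE _ _ ih₁ ih₂ => exact ih₁ x hx (ih₂ x hx)
  | raa _ ih =>
    by_contra hφ
    exact ih x (Set.forall_mem_insert.2 ⟨hφ, hx⟩)
  | allI _ ih =>
    -- The weakened assumptions ignore the new variable, so its value `a` is arbitrary.
    exact fun a => ih _ (Set.forall_mem_image.2 fun ψ hψ => (sat_wk ψ x a).2 (hx ψ hψ))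
  | allE t _ ih => exact (sat_inst _ t x).2 (ih x hx _)
  | eqRefl t => rfl
  | eqSubst φ _ _ ih₁ ih₂ =>
    have h₁ := (sat_equal _ _ x).1 (ih₁ x hx)
    have h₂ := (sat_inst _ _ x).1 (ih₂ x hx)
    exact (sat_inst _ _ x).2 (h₁ ▸ h₂)

end FOL

/-! ### The standard model of `ID₁` -/

namespace ID1

open FirstOrder FirstOrder.Language FOL

/-- The meaning of the predicate symbols in the standard model, with `I` interpreted as `S`. -/
def Rel.Eval (S : Set ℕ) : {n : ℕ} → Rel n → (Fin n → ℕ) → Prop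
  | _, .arith f, x => f.eval x = 0
  | _, .I, x => x 0 ∈ S

/-- The standard model of arithmetic, with `I` interpreted as `S`. -/
@[reducible] def model (S : Set ℕ) : lang.Structure ℕ where
  funMap := fun (f : PR _) x => f.eval x
  RelMap := fun (R : Rel _) x => R.Eval S x

/-- The value of a term in the standard model. -/
def value {n : ℕ} (t : Tm lang n) (x : Fin n → ℕ) : ℕ :=
  letI := model ∅
  val t x

/-- Truth of a formula in the standard model with `I` interpreted as `S`. -/
def Holds (S : Set ℕ) {n : ℕ} (φ : Fm lang n) (x : Fin n → ℕ) : Prop :=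
  letI := model S
  Sat φ x

/-- Terms contain no predicate symbols, so the choice of `∅` in `value` is immaterial. -/
theorem val_model (S : Set ℕ) {n : ℕ} (t : Tm lang n) (x : Fin n → ℕ) :
    (letI := model S; val t x) = value t x := by
  unfold value val
  induction t with
  | var i => rfl
  | func f ts ih => exact congrArg (PR.eval f) (funext ih)

@[simp] theorem value_v {n : ℕ} (i : Fin n) (x : Fin n → ℕ) : value (v i) x = x i := rfl

@[simp] theorem value_app {n k : ℕ} (f : PR k) (ts : Fin k → Tm lang n) (x : Fin n → ℕ) :
    value (app f ts) x = f.eval (fun i => value (ts i) x) := rfl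

@[simp] theorem value_zeroT {n : ℕ} (x : Fin n → ℕ) : value zeroT x = 0 := rfl

@[simp] theorem value_succT {n : ℕ} (t : Tm lang n) (x : Fin n → ℕ) :
    value (succT t) x = value t x + 1 := rfl

variable (S : Set ℕ)

@[simp] theorem holds_equal {n : ℕ} (s t : Tm lang n) (x : Fin n → ℕ) :
    Holds S (.equal s t) x ↔ value s x = value t x := by
  rw [← val_model S s, ← val_model S t]; rfl

@[simp] theorem holds_relF {n k : ℕ} (f : PR k) (ts : Fin k → Tm lang n) (x : Fin n → ℕ) :
    Holds S (relF f ts) x ↔ f.eval (fun i => value (ts i) x) = 0 := by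
  simp only [← val_model S]; rfl

theorem holds_rel_I {n : ℕ} (ts : Fin 1 → Tm lang n) (x : Fin n → ℕ) :
    Holds S (.rel (L := lang) Rel.I ts) x ↔ value (ts 0) x ∈ S := by
  rw [← val_model S]; rfl

@[simp] theorem holds_mem {n : ℕ} (t : Tm lang n) (x : Fin n → ℕ) :
    Holds S (mem t) x ↔ value t x ∈ S := holds_rel_I S _ x

@[simp] theorem holds_imp {n : ℕ} (φ ψ : Fm lang n) (x : Fin n → ℕ) :
    Holds S (φ.imp ψ) x ↔ (Holds S φ x → Holds S ψ x) := Iff.rfl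

@[simp] theorem holds_all {n : ℕ} (φ : Fm lang (n + 1)) (x : Fin n → ℕ) :
    Holds S φ.all x ↔ ∀ a : ℕ, Holds S φ (Fin.snoc (α := fun _ => ℕ) x a) := Iff.rfl

@[simp] theorem holds_not {n : ℕ} (φ : Fm lang n) (x : Fin n → ℕ) :
    Holds S φ.not x ↔ ¬ Holds S φ x := Iff.rfl

@[simp] theorem holds_inf {n : ℕ} (φ ψ : Fm lang n) (x : Fin n → ℕ) :
    Holds S (φ ⊓ ψ) x ↔ Holds S φ x ∧ Holds S ψ x :=
  letI := model S
  sat_inf φ ψ x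

@[simp] theorem holds_iff {n : ℕ} (φ ψ : Fm lang n) (x : Fin n → ℕ) :
    Holds S (φ.iff ψ) x ↔ (Holds S φ x ↔ Holds S ψ x) :=
  letI := model S
  sat_iff φ ψ x

theorem holds_alls {n : ℕ} (φ : Fm lang n) (x : Fin 0 → ℕ) :
    Holds S φ.alls x ↔ ∀ y : Fin n → ℕ, Holds S φ y :=
  letI := model S
  sat_alls φ x

theorem holds_subst {n m : ℕ} (φ : Fm lang n) (σ : Fin n → Tm lang m) (x : Fin m → ℕ) :
    Holds S (subst φ σ) x ↔ Holds S φ (fun i => value (σ i) x) := by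
  simp only [← val_model S]
  exact @sat_subst _ _ (model S) _ φ _ σ x

theorem holds_subst_snoc {n m : ℕ} (φ : Fm lang (n + 1)) (σ : Fin n → Tm lang m) (t : Tm lang m)
    (x : Fin m → ℕ) :
    Holds S (subst φ (Fin.snoc (α := fun _ => Tm lang m) σ t)) x ↔
      Holds S φ (Fin.snoc (α := fun _ => ℕ) (fun i => value (σ i) x) (value t x)) := by
  rw [holds_subst]
  exact iff_of_eq (congrArg _ (@val_snoc _ _ (model ∅) _ _ σ t x))

theorem holds_inst {n : ℕ} (φ : Fm lang (n + 1)) (t : Tm lang n) (x : Fin n → ℕ) :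
    Holds S (inst φ t) x ↔ Holds S φ (Fin.snoc (α := fun _ => ℕ) x (value t x)) :=
  holds_subst_snoc S φ v t x

/-! ### Positivity, and replacement of `I` by a formula -/

/-- A formula is monotone in `I` if `I` occurs only positively, and antitone if `I` occurs only
negatively. -/
theorem Occurs.holds_mono {S T : Set ℕ} (hST : S ⊆ T) {n : ℕ} (φ : Fm lang n) (x : Fin n → ℕ) :
    (Occurs true φ → Holds S φ x → Holds T φ x) ∧
      (Occurs false φ → Holds T φ x → Holds S φ x) := by
  induction φ with
  | falsum => exact ⟨fun _ => id, fun _ => id⟩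
  | equal s t => simp
  | rel R ts =>
    cases R with
    | arith f =>
      have h := (holds_relF S f ts x).trans (holds_relF T f ts x).symm
      exact ⟨fun _ => h.1, fun _ => h.2⟩
    | I =>
      refine ⟨fun _ h => ?_, fun h => absurd h (by simp [Occurs])⟩
      exact (holds_rel_I T ts x).2 (hST ((holds_rel_I S ts x).1 h))
  | imp φ ψ ihφ ihψ =>
    -- The premise of an implication has the opposite polarity, so each half needs the other half
    -- for `φ`.
    exact ⟨fun h hS hφ => (ihψ x).1 h.2 (hS ((ihφ x).2 h.1 hφ)),
      fun h hT hφ => (ihψ x).2 h.2 (hT ((ihφ x).1 h.1 hφ))⟩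
  | all φ ih =>
    exact ⟨fun h hS a => (ih _).1 h (hS a), fun h hT a => (ih _).2 h (hT a)⟩

/-- Replacing `I` by a formula amounts to reinterpreting `I` as the set which that formula defines.
Under a quantifier `ρ` is followed by `castSucc`, so the parameters keep their values and the set
stays the same. -/
theorem holds_replaceI {n : ℕ} (φ : Fm lang (n + 1)) {k : ℕ} (ρ : Fin n → Fin k) (χ : Fm lang k)
    (x : Fin k → ℕ) :
    Holds S (replaceI φ ρ χ) x ↔
      Holds {a | Holds S φ (Fin.snoc (α := fun _ => ℕ) (fun i => x (ρ i)) a)} χ x := by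
  induction χ with
  | falsum => exact Iff.rfl
  | equal s t => simp [replaceI]
  | rel R ts =>
    cases R with
    | arith f => exact (holds_relF S f ts x).trans (holds_relF _ f ts x).symm
    | I =>
      rw [holds_rel_I]
      exact holds_subst_snoc S φ _ _ x
  | imp χ ψ ihχ ihψ => simp [replaceI, ihχ, ihψ]
  | all χ ih => simp [replaceI, ih]

theorem holds_plug {n : ℕ} (A : Fm lang 1) (φ : Fm lang (n + 1)) (x : Fin n → ℕ) (a : ℕ) :
    Holds S (plug A φ) (Fin.snoc (α := fun _ => ℕ) x a) ↔
      Holds {b | Holds S φ (Fin.snoc (α := fun _ => ℕ) x b)} A (fun _ => a) := by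
  simp [plug, holds_replaceI, holds_subst]

/-! ### The least fixed point and the truth of the axioms -/

/-- The monotone operator defined by an operator form. -/
def operator (A : Fm lang 1) (hA : Occurs true A) : Set ℕ →o Set ℕ where
  toFun S := {a | Holds S A (fun _ => a)}
  monotone' _ _ hST _ h := (Occurs.holds_mono hST A _).1 hA h

/-- The set inductively defined by an operator form. -/
def fixedPoint (A : Fm lang 1) (hA : Occurs true A) : Set ℕ := OrderHom.lfp (operator A hA)

theorem mem_fixedPoint (A : Fm lang 1) (hA : Occurs true A) (a : ℕ) :
    a ∈ fixedPoint A hA ↔ Holds (fixedPoint A hA) A (fun _ => a) :=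
  iff_of_eq (congrArg (a ∈ ·) (OrderHom.map_lfp (operator A hA)).symm)

theorem fixedPoint_subset (A : Fm lang 1) (hA : Occurs true A) {S : Set ℕ}
    (hS : ∀ a, Holds S A (fun _ => a) → a ∈ S) : fixedPoint A hA ⊆ S :=
  OrderHom.lfp_le (operator A hA) hS

/-- The axioms of `ID₁` are true in the standard model if `I` is interpreted as the least fixed
point of the operator form. -/
theorem IsAxiom.holds {A : Fm lang 1} (hA : Occurs true A) {σ : lang.Sentence}
    (h : IsAxiom A σ) (x : Fin 0 → ℕ) : Holds (fixedPoint A hA) σ x := by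
  induction h with
  | succ_ne_zero => simp [holds_alls]
  | succ_inj => simp [holds_alls]
  | proj i => simp [holds_alls, PR.eval]
  | comp f g => simp [holds_alls, PR.eval]
  | prec_zero f g =>
    simp only [holds_alls, holds_equal, value_app]
    intro y
    rfl
  | prec_succ f g =>
    simp only [holds_alls, holds_equal, value_app]
    intro y
    simp only [PR.eval, Fin.cons_zero, value_succT, value_v]
    congr 1
    funext i
    -- The first two arguments of `g` are the recursion variable and the previous value; the rest
    -- are parameters.
    refine Fin.cases rfl (fun i => ?_) i
    refine Fin.cases rfl (fun i => rfl) i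
  | pred f => simp [holds_alls]
  | induction φ =>
    rw [holds_alls]
    simp only [holds_imp, holds_inf, holds_inst, holds_all, holds_subst_snoc, value_zeroT,
      value_succT, value_v, Fin.snoc_last, Fin.snoc_castSucc]
    intro y ⟨h₀, hs⟩ a
    exact Nat.rec h₀ (fun a => hs a) a
  | inductiveDefinition =>
    simp only [holds_all, holds_iff, holds_mem, value_v]
    intro a
    rw [show (Fin.snoc (α := fun _ => ℕ) x a : Fin 1 → ℕ) = fun _ => a from
      funext fun i => Fin.fin_one_eq_zero i ▸ rfl]
    exact mem_fixedPoint A hA a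
  | inductiveClosure φ =>
    rw [holds_alls]
    simp only [holds_imp, holds_all, holds_mem, holds_plug, value_v, Fin.snoc_last]
    -- For fixed parameters `y`, `hy` says that the set defined by `φ` is closed under the operator.
    exact fun y hy a ha => fixedPoint_subset A hA hy ha

/-- For every `S`, `model S` expands the standard model of arithmetic, so arithmetical formulas keep
their truth values. -/
theorem holds_incl {n : ℕ} (φ : Fm arith n) (x : Fin n → ℕ) :
    Holds S (incl.onBoundedFormula φ) x ↔ φ.Realize Empty.elim x := by
  let := model S
  have : incl.IsExpansionOn ℕ := ⟨fun _ _ => rfl, fun _ _ => rfl⟩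
  exact LHom.realize_onBoundedFormula incl φ

end ID1

theorem mainTheorem1 (A : FOL.Fm ID1.lang 1) (hA : ID1.Occurs true A)
    (φ : FOL.Fm ID1.arith 1) (hφ : φ.IsQF)
    (hprov : FOL.Provable (ID1.theory A) (ID1.incl.onBoundedFormula φ).ex) :
    ∃ n : ℕ, φ.Realize Empty.elim ![n] := by
  let := ID1.model (ID1.fixedPoint A hA)
  obtain ⟨n, hn⟩ := (FOL.sat_ex _ _).1
    (FOL.Derives.sound hprov ![] fun _ hψ => ID1.IsAxiom.holds hA hψ ![])
  refine ⟨n, ?_⟩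
  convert (ID1.holds_incl _ φ _).1 hn using 1
  funext i
  rw [Fin.fin_one_eq_zero i]
  rfl
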